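/- Let $\mathbb{C}_\infty=\mathbb{C}\cup\{\infty\}$ denote the Riemann sphere, and for an open set $\Omega\subset\mathbb{C}_\infty$ let $H^\infty(\Omega)$ be the set of bounded holomorphic functions $f:\Omega\to\mathbb{C}$. A compact set $E\subset\mathbb{C}$ is called $H^\infty$-removable if every function in $H^\infty(\mathbb{C}_\infty\setminus E)$ is constant. (1) If $E,F\subset\mathbb{C}$ are $H^\infty$-removable compact sets, then $E\cup F$ is also $H^\infty$-removable. (2) Let $U\subset\mathbb{C}$ be open and let $E\subset\mathbb{C}$ be compact and $H^\infty$-removable (it is not assumed that $E\subset U$). Then every bounded holomorphic function on $U\setminus E$ has an analytic extension to an element of $H^\infty(U)$. -/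

import Mathlib

open scoped OnePoint

namespace HInfty

noncomputable section

/-- The Riemann sphere `ℂ ∪ {∞}`. -/
abbrev Sphere : Type := OnePoint ℂ

open Classical in
/-- The inverse of the chart `1 / z` of the sphere around `∞`: it sends `0` to `∞` and
`w ≠ 0` to the finite point `w⁻¹`. -/
def atInfty (w : ℂ) : Sphere := if w = 0 then ∞ else ((w⁻¹ : ℂ) : Sphere)

/-- Holomorphy of a complex valued function on a subset `Ω` of the sphere (meant for open `Ω`):
it is holomorphic in each of the two standard charts `z` and `w = 1 / z`.
Only the values of `f` on `Ω` matter. -/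
def SphereHolomorphicOn (f : Sphere → ℂ) (Ω : Set Sphere) : Prop :=
  DifferentiableOn ℂ (fun z : ℂ => f (z : Sphere)) {z : ℂ | (z : Sphere) ∈ Ω} ∧
  DifferentiableOn ℂ (fun w : ℂ => f (atInfty w)) {w : ℂ | atInfty w ∈ Ω}

/-- `f ∈ H^∞(Ω)` for an open subset `Ω` of the sphere: `f` is holomorphic and bounded on `Ω`. -/
def MemSphere (f : Sphere → ℂ) (Ω : Set Sphere) : Prop :=
  SphereHolomorphicOn f Ω ∧ ∃ C : ℝ, ∀ z ∈ Ω, ‖f z‖ ≤ C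

/-- `f ∈ H^∞(U)` for an open subset `U` of the plane: `f` is holomorphic and bounded on `U`. -/
def MemPlane (f : ℂ → ℂ) (U : Set ℂ) : Prop :=
  DifferentiableOn ℂ f U ∧ ∃ C : ℝ, ∀ z ∈ U, ‖f z‖ ≤ C

/-- The complement `ℂ_∞ \ E` of a plane set in the sphere. -/
def sphereCompl (E : Set ℂ) : Set Sphere := ((fun z : ℂ => (z : Sphere)) '' E)ᶜ

/-- A compact set `E ⊆ ℂ` is `H^∞`-removable if every bounded holomorphic function on
`ℂ_∞ \ E` is constant. -/
def Removable (E : Set ℂ) : Prop :=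
  ∀ f : Sphere → ℂ, MemSphere f (sphereCompl E) → ∃ c : ℂ, ∀ z ∈ sphereCompl E, f z = c

end

end HInfty

/-!
The proof is the localization of bounded holomorphic functions by the Cauchy transform
`C ψ (z) = π⁻¹ ∫ ψ(w) / (z - w) dA(w)`. For a bounded density of compact support, `C ψ` is
bounded, tends to `0` at `∞`, and is holomorphic wherever `ψ` vanishes; moreover `C (∂u/∂z̄) = u`
for compactly supported `u` of class `C¹` (the Cauchy–Pompeiu formula, `cauchyTransform_dbar`,
proved by integrating in polar coordinates).

Let `f` be bounded and holomorphic on `U \ E`, let `h` be its extension by `0`, and let `φ` be a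
cutoff function supported in `U` and equal to `1` near a point `p ∈ U`. The function
`φ h - C (h ∂φ/∂z̄)` is bounded, vanishes at `∞`, and is holomorphic off `E`
(`differentiableAt_mul_sub_cauchyTransform`), so it vanishes off `E` if `E` is removable. Near `p`
this says that `f = C (h ∂φ/∂z̄)` off `E`, and the right-hand side is holomorphic near `p`
(`Removable.exists_local_extension`). No assumption on the position of `E` relative to `U`, and no
knowledge of the size of `E`, is needed. The local extensions agree with each other because a
removable set has empty interior (`Removable.dense_compl`), which proves the extension property
`Removable.exists_extension`.

For a union, a function in `H^∞(ℂ_∞ \ (E ∪ F))` extends across `E`, by the extension property for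
the plane open set `ℂ \ F`, and the extension is constant because `F` is removable.
-/

namespace HInfty

open MeasureTheory Set Filter Topology Metric

/-! ### The Cauchy–Pompeiu formula -/

/-- The Wirtinger derivative `∂u/∂z̄ = (∂u/∂x + i ∂u/∂y) / 2` of a real differentiable function. -/
noncomputable def dbar (u : ℂ → ℂ) (z : ℂ) : ℂ :=
  (1 / 2) * (fderiv ℝ u z 1 + Complex.I * fderiv ℝ u z Complex.I)

lemma continuous_dbar {u : ℂ → ℂ} (hu : ContDiff ℝ 1 u) : Continuous (dbar u) := by
  have h := hu.continuous_fderiv one_ne_zero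
  unfold dbar
  fun_prop

lemma support_dbar_subset (u : ℂ → ℂ) : Function.support (dbar u) ⊆ tsupport u := by
  intro z hz
  by_contra h
  have : fderiv ℝ u z = 0 := by
    by_contra h'
    exact h (support_fderiv_subset ℝ h')
  simp [dbar, this] at hz

lemma dbar_eq_zero_of_notMem_tsupport {u : ℂ → ℂ} {z : ℂ} (h : z ∉ tsupport u) : dbar u z = 0 := by
  by_contra h'
  exact h (support_dbar_subset u h')

lemma hasCompactSupport_dbar {u : ℂ → ℂ} (hu : HasCompactSupport u) :
    HasCompactSupport (dbar u) :=
  hu.mono' (support_dbar_subset u)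

lemma dbar_congr {u v : ℂ → ℂ} {z : ℂ} (h : u =ᶠ[𝓝 z] v) : dbar u z = dbar v z := by
  simp only [dbar, h.fderiv_eq]

lemma dbar_eq_zero_of_differentiableAt {u : ℂ → ℂ} {z : ℂ} (h : DifferentiableAt ℂ u z) :
    dbar u z = 0 := by
  have hI : fderiv ℂ u z Complex.I = Complex.I * fderiv ℂ u z 1 := by
    simp
  simp only [dbar, h.fderiv_restrictScalars ℝ, ContinuousLinearMap.coe_restrictScalars', hI]
  linear_combination (1 / 2 * fderiv ℂ u z 1) * Complex.I_mul_I

lemma dbar_mul {u v : ℂ → ℂ} {z : ℂ} (hu : DifferentiableAt ℝ u z) (hv : DifferentiableAt ℝ v z) :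
    dbar (fun w => u w * v w) z = u z * dbar v z + dbar u z * v z := by
  simp only [dbar, fderiv_fun_mul hu hv]
  simp only [add_apply, smul_apply, smul_eq_mul]
  ring

lemma dbar_comp_const_sub (u : ℂ → ℂ) (hu : Differentiable ℝ u) (z ζ : ℂ) :
    dbar (fun w => u (z - w)) ζ = -dbar u (z - ζ) := by
  have : HasFDerivAt (fun w => u (z - w)) (-fderiv ℝ u (z - ζ)) ζ := by
    have h1 : HasFDerivAt (fun w : ℂ => z - w) (-ContinuousLinearMap.id ℝ ℂ) ζ :=
      (hasFDerivAt_id ζ).const_sub z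
    have h2 := (hu (z - ζ)).hasFDerivAt.comp ζ h1
    refine h2.congr_fderiv ?_
    ext
    simp
  simp only [dbar, this.fderiv, neg_apply]
  ring

/-- A continuous function of the polar coordinates vanishing for large radius is integrable. -/
lemma integrableOn_polarCoord_target {f : ℝ × ℝ → ℂ} (hf : Continuous f) {R : ℝ}
    (hR : ∀ p : ℝ × ℝ, R < p.1 → f p = 0) :
    IntegrableOn f (Ioi (0 : ℝ) ×ˢ Ioo (-Real.pi) Real.pi) := by
  have h1 : IntegrableOn f (Icc 0 R ×ˢ Icc (-Real.pi) Real.pi) :=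
    hf.continuousOn.integrableOn_compact (isCompact_Icc.prod isCompact_Icc)
  have h2 : IntegrableOn f (Ioc 0 R ×ˢ Ioo (-Real.pi) Real.pi) :=
    h1.mono_set (prod_mono Ioc_subset_Icc_self Ioo_subset_Icc_self)
  refine h2.of_forall_sdiff_eq_zero (measurableSet_Ioi.prod measurableSet_Ioo) ?_
  rintro ⟨r, t⟩ ⟨⟨hr, ht⟩, h⟩
  refine hR _ ?_
  by_contra h'
  exact h ⟨⟨hr, not_lt.1 h'⟩, ht⟩

/-- The Cauchy–Pompeiu formula at the origin. In polar coordinates the integrand is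
`(∂v/∂r + (i / r) ∂v/∂θ) / 2`: the angular term integrates to zero over each circle, the
radial one to `-v 0` along each ray. -/
lemma integral_dbar_mul_inv {v : ℂ → ℂ} (hv : ContDiff ℝ 1 v) (hc : HasCompactSupport v) :
    ∫ w, dbar v w * w⁻¹ = -(Real.pi * v 0) := by
  set e : ℝ → ℂ := fun t => Real.cos t + Real.sin t * Complex.I with he
  have hee : ∀ t, e t * (Real.cos t - Real.sin t * Complex.I) = 1 := by
    intro t
    have h := Complex.sin_sq_add_cos_sq t
    simp only [he, Complex.ofReal_cos, Complex.ofReal_sin]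
    linear_combination h - Complex.sin t ^ 2 * Complex.I_sq
  have hde : ∀ t, HasDerivAt e (Complex.I * e t) t := by
    intro t
    have h1 := (Real.hasDerivAt_cos t).ofReal_comp
    have h2 := ((Real.hasDerivAt_sin t).ofReal_comp).mul_const Complex.I
    refine (h1.add h2).congr_deriv ?_
    simp only [he]
    push_cast
    linear_combination (-Complex.sin t) * Complex.I_sq
  have hecont : Continuous e := by fun_prop
  have henorm : ∀ t, ‖e t‖ = 1 := by
    intro t
    have := Complex.norm_exp_ofReal_mul_I t
    rwa [Complex.exp_mul_I, ← Complex.ofReal_cos, ← Complex.ofReal_sin] at this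
  have hD := hv.continuous_fderiv one_ne_zero
  have hvd : Differentiable ℝ v := hv.differentiable one_ne_zero
  -- In polar coordinates `A` is `∂v/∂r` and `B` is `(1 / r) ∂v/∂θ`.
  set A : ℝ × ℝ → ℂ := fun p => fderiv ℝ v (p.1 * e p.2) (e p.2) with hA
  set B : ℝ × ℝ → ℂ := fun p => fderiv ℝ v (p.1 * e p.2) (Complex.I * e p.2) with hB
  have hAc : Continuous A := by fun_prop
  have hBc : Continuous B := by fun_prop
  obtain ⟨R, hR⟩ := hc.isBounded.subset_closedBall 0
  have hout : ∀ r t : ℝ, R < r → (r : ℂ) * e t ∉ tsupport v := by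
    intro r t hr hmem
    have := hR hmem
    rw [mem_closedBall_zero_iff, norm_mul, henorm, mul_one, Complex.norm_real] at this
    linarith [Real.le_norm_self r]
  have hzero : ∀ r t : ℝ, R < r → fderiv ℝ v ((r : ℂ) * e t) = 0 := by
    intro r t hr
    by_contra h'
    exact hout r t hr (support_fderiv_subset ℝ h')
  have hAi := integrableOn_polarCoord_target hAc (R := R) (fun p hp => by
    simp only [hA, hzero _ _ hp, zero_apply])
  have hBi := integrableOn_polarCoord_target hBc (R := R) (fun p hp => by
    simp only [hB, hzero _ _ hp, zero_apply])
  have hAint : ∫ p in Ioi (0 : ℝ) ×ˢ Ioo (-Real.pi) Real.pi, A p = -(2 * Real.pi * v 0) := by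
    have hray : ∀ t, ∫ r in Ioi (0 : ℝ), A (r, t) = -v 0 := by
      intro t
      have hder : ∀ r : ℝ, HasDerivAt (fun r : ℝ => v (r * e t)) (A (r, t)) r := by
        intro r
        have h1 : HasDerivAt (fun r : ℝ => (r : ℂ) * e t) (e t) r := by
          simpa using (Complex.ofRealCLM.hasDerivAt (x := r)).mul_const (e t)
        exact (hvd _).hasFDerivAt.comp_hasDerivAt r h1
      have hAt : Continuous fun r : ℝ => A (r, t) := by fun_prop
      rw [integral_Ioi_of_hasDerivAt_of_tendsto' (m := 0) (fun r _ => hder r)]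
      · simp
      · refine (hAt.continuousOn.integrableOn_compact (isCompact_Icc (a := 0) (b := R))).mono_set
          Ioc_subset_Icc_self |>.of_forall_sdiff_eq_zero measurableSet_Ioi ?_
        rintro r ⟨hr, h⟩
        have : R < r := by
          by_contra h'
          exact h ⟨hr, not_lt.1 h'⟩
        simp only [hA, hzero _ _ this, zero_apply]
      · refine tendsto_const_nhds.congr' ?_
        filter_upwards [eventually_gt_atTop R] with r hr
        exact (image_eq_zero_of_notMem_tsupport (hout r t hr)).symm
    rw [Measure.volume_eq_prod, ← Measure.prod_restrict, integral_prod_symm _ (by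
      rw [Measure.prod_restrict]; exact hAi)]
    simp only [hray, setIntegral_const]
    simp only [measureReal_def, Real.volume_Ioo]
    rw [ENNReal.toReal_ofReal (by linarith [Real.pi_pos])]
    simp only [Complex.real_smul]
    push_cast
    ring
  have hBint : ∫ p in Ioi (0 : ℝ) ×ˢ Ioo (-Real.pi) Real.pi, B p = 0 := by
    have hcirc : ∀ r ∈ Ioi (0 : ℝ), ∫ t in Ioo (-Real.pi) Real.pi, B (r, t) = 0 := by
      intro r hr
      have hder : ∀ t : ℝ, HasDerivAt (fun t : ℝ => v (r * e t)) (r * B (r, t)) t := by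
        intro t
        have h1 : HasDerivAt (fun t : ℝ => (r : ℂ) * e t) (r * (Complex.I * e t)) t :=
          (hde t).const_mul _
        have h2 := (hvd _).hasFDerivAt.comp_hasDerivAt t h1
        refine h2.congr_deriv ?_
        have := (fderiv ℝ v (r * e t)).map_smul r (Complex.I * e t)
        simpa using this
      have hBt : Continuous fun t : ℝ => (r : ℂ) * B (r, t) := by fun_prop
      have h3 : ∫ t in (-Real.pi)..Real.pi, (r : ℂ) * B (r, t) = 0 := by
        rw [intervalIntegral.integral_eq_sub_of_hasDerivAt (fun t _ => hder t)
          (hBt.intervalIntegrable _ _)]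
        simp [he]
      rw [intervalIntegral.integral_const_mul, intervalIntegral.integral_of_le (by
        linarith [Real.pi_pos]), integral_Ioc_eq_integral_Ioo] at h3
      exact (mul_eq_zero.1 h3).resolve_left (by exact_mod_cast (ne_of_gt hr))
    rw [Measure.volume_eq_prod, setIntegral_prod _ hBi,
      setIntegral_congr_fun measurableSet_Ioi hcirc]
    simp
  rw [← Complex.integral_comp_polarCoord_symm, polarCoord_target]
  have hcongr : ∀ p ∈ Ioi (0 : ℝ) ×ˢ Ioo (-Real.pi) Real.pi,
      p.1 • (dbar v (Complex.polarCoord.symm p) * (Complex.polarCoord.symm p)⁻¹) =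
        (1 / 2) * (A p + Complex.I * B p) := by
    rintro ⟨r, t⟩ ⟨hr, -⟩
    have hr0 : (r : ℂ) ≠ 0 := by exact_mod_cast (ne_of_gt hr)
    have hP : Complex.polarCoord.symm (r, t) = r * e t := by
      rw [Complex.polarCoord_symm_apply]
    have hlin : ∀ a b : ℝ, fderiv ℝ v (r * e t) (a + b * Complex.I) =
        a * fderiv ℝ v (r * e t) 1 + b * fderiv ℝ v (r * e t) Complex.I := by
      intro a b
      have h1 := (fderiv ℝ v (r * e t)).map_smul a 1
      have h2 := (fderiv ℝ v (r * e t)).map_smul b Complex.I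
      simp only [Complex.real_smul, mul_one] at h1 h2
      rw [map_add, h1, h2]
    have hIe : Complex.I * e t = ((-Real.sin t : ℝ) : ℂ) + (Real.cos t : ℝ) * Complex.I := by
      simp only [he]
      push_cast
      linear_combination Complex.sin t * Complex.I_sq
    have hinv : ((r : ℂ) * e t)⁻¹ = (r : ℂ)⁻¹ * (Real.cos t - Real.sin t * Complex.I) := by
      rw [mul_inv, eq_comm, ← eq_inv_of_mul_eq_one_right (hee t)]
    simp only [hP, hA, hB, hIe, dbar, hinv, Complex.real_smul]
    rw [show e t = (Real.cos t : ℂ) + (Real.sin t : ℝ) * Complex.I from rfl]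
    rw [hlin, hlin, ← show e t = (Real.cos t : ℂ) + (Real.sin t : ℝ) * Complex.I from rfl]
    push_cast
    field_simp
    linear_combination (-(fderiv ℝ v (r * e t) Complex.I) * Complex.sin t) * Complex.I_sq
  rw [setIntegral_congr_fun (measurableSet_Ioi.prod measurableSet_Ioo) hcongr, integral_const_mul,
    integral_add hAi (hBi.const_mul _), integral_const_mul, hAint, hBint]
  ring

/-! ### The Cauchy transform of a bounded density -/

/-- The Cauchy transform `z ↦ π⁻¹ ∫ ψ(w) / (z - w) dA(w)`, normalized so as to invert `∂/∂z̄`. -/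
noncomputable def cauchyTransform (ψ : ℂ → ℂ) (z : ℂ) : ℂ :=
  (Real.pi : ℂ)⁻¹ * ∫ w, ψ w * (z - w)⁻¹

/-- The Cauchy–Pompeiu formula for compactly supported functions. -/
lemma cauchyTransform_dbar {u : ℂ → ℂ} (hu : ContDiff ℝ 1 u) (hc : HasCompactSupport u) (z : ℂ) :
    cauchyTransform (dbar u) z = u z := by
  have hv : ContDiff ℝ 1 (fun w => u (z - w)) := hu.comp (contDiff_const.sub contDiff_id)
  have hvc : HasCompactSupport (fun w => u (z - w)) :=
    hc.comp_homeomorph (Homeomorph.subLeft z)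
  have h := integral_dbar_mul_inv hv hvc
  simp only [dbar_comp_const_sub u (hu.differentiable one_ne_zero), sub_zero, neg_mul,
    integral_neg, neg_inj] at h
  have h2 := integral_sub_left_eq_self (fun w => dbar u w * (z - w)⁻¹) volume z
  simp only [sub_sub_cancel] at h2
  rw [cauchyTransform, ← h2, h, inv_mul_cancel_left₀]
  exact_mod_cast Real.pi_ne_zero

/-- A bounded measurable function with bounded support. -/
structure BoundedDensity (ψ : ℂ → ℂ) : Prop where
  aestronglyMeasurable : AEStronglyMeasurable ψ
  exists_bound : ∃ M, ∀ w, ‖ψ w‖ ≤ M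
  exists_radius : ∃ R, ∀ w, R < ‖w‖ → ψ w = 0

lemma BoundedDensity.of_continuous {ψ : ℂ → ℂ} (h : Continuous ψ) (hc : HasCompactSupport ψ) :
    BoundedDensity ψ where
  aestronglyMeasurable := h.aestronglyMeasurable
  exists_bound := h.bounded_above_of_compact_support hc |>.imp fun _ h => h
  exists_radius := by
    obtain ⟨R, hR⟩ := hc.isBounded.subset_closedBall 0
    refine ⟨R, fun w hw => image_eq_zero_of_notMem_tsupport fun h => ?_⟩
    have := hR h
    rw [mem_closedBall_zero_iff] at this
    linarith

lemma BoundedDensity.mul {ψ h : ℂ → ℂ} (hψ : BoundedDensity ψ) (hm : AEStronglyMeasurable h)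
    (hb : ∃ M, ∀ w, ‖h w‖ ≤ M) : BoundedDensity (fun w => h w * ψ w) where
  aestronglyMeasurable := hm.mul hψ.aestronglyMeasurable
  exists_bound := by
    obtain ⟨M, hM⟩ := hψ.exists_bound
    obtain ⟨N, hN⟩ := hb
    refine ⟨N * M, fun w => ?_⟩
    rw [norm_mul]
    exact mul_le_mul (hN w) (hM w) (norm_nonneg _) ((norm_nonneg _).trans (hN w))
  exists_radius := hψ.exists_radius.imp fun R hR w hw => by simp [hR w hw]

/-- The singular part of the Cauchy kernel, `1 / |ζ|` on the unit disc, is integrable. -/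
lemma integrable_indicator_ball_inv_norm :
    Integrable (fun ζ : ℂ => (Iio (1 : ℝ)).indicator (fun r => r⁻¹) ‖ζ‖) := by
  rw [integrable_fun_norm_addHaar volume (f := (Iio (1 : ℝ)).indicator (fun r => r⁻¹))]
  simp only [Complex.finrank_real_complex]
  have h1 : IntegrableOn (fun _ : ℝ => (1 : ℝ)) (Ioo 0 1) := by simp
  have h2 : IntegrableOn ((Iio (1 : ℝ)).indicator fun _ => (1 : ℝ)) (Ioi 0) := by
    rw [integrableOn_indicator_iff measurableSet_Iio]
    exact h1.mono_set fun x hx => ⟨hx.2, hx.1⟩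
  refine h2.congr_fun (fun r hr => ?_) measurableSet_Ioi
  by_cases h : r < 1 <;> simp [h, (ne_of_gt hr : r ≠ 0)]

/-- The integrand of the Cauchy transform has an integrable majorant whose integral does not
depend on the point. -/
lemma BoundedDensity.exists_majorant {ψ : ℂ → ℂ} (hψ : BoundedDensity ψ) :
    ∃ C, ∀ z, ∃ g : ℂ → ℝ, Integrable g ∧ (∀ w, ‖ψ w * (z - w)⁻¹‖ ≤ g w) ∧ ∫ w, g w = C := by
  obtain ⟨M, hM⟩ := hψ.exists_bound
  obtain ⟨R, hR⟩ := hψ.exists_radius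
  have hM0 : 0 ≤ M := (norm_nonneg _).trans (hM 0)
  set k : ℂ → ℝ := fun ζ => (Iio (1 : ℝ)).indicator (fun r => r⁻¹) ‖ζ‖ with hk
  set b : ℂ → ℝ := (closedBall (0 : ℂ) R).indicator fun _ => 1 with hb
  have hbi : Integrable b := by
    rw [hb, integrable_indicator_iff isClosed_closedBall.measurableSet]
    exact continuousOn_const.integrableOn_compact (isCompact_closedBall _ _)
  have hki (z : ℂ) : Integrable (fun w => k (z - w)) := by
    simpa using integrable_indicator_ball_inv_norm.comp_sub_left z
  have hk0 : ∀ ζ, 0 ≤ k ζ := fun ζ => by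
    simp only [hk, indicator_apply]
    split_ifs <;> positivity
  refine ⟨M * (∫ ζ, k ζ) + M * ∫ w, b w, fun z =>
    ⟨fun w => M * k (z - w) + M * b w, ((hki z).const_mul M).add (hbi.const_mul M), ?_, ?_⟩⟩
  · intro w
    by_cases hw : R < ‖w‖
    · have : 0 ≤ b w := indicator_nonneg (by simp) _
      simp only [hR w hw, zero_mul, norm_zero]
      have := hk0 (z - w)
      positivity
    · have hbw : b w = 1 := by
        rw [hb, indicator_of_mem (by simpa using hw)]
      beta_reduce
      rw [hbw, ← mul_add, norm_mul, norm_inv]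
      refine mul_le_mul (hM w) ?_ (by positivity) hM0
      by_cases h1 : ‖z - w‖ < 1
      · simp [hk, h1]
      · have : ‖z - w‖⁻¹ ≤ 1 := inv_le_one_of_one_le₀ (not_lt.1 h1)
        linarith [hk0 (z - w)]
  · rw [integral_add ((hki z).const_mul M) (hbi.const_mul M), integral_const_mul,
      integral_const_mul, integral_sub_left_eq_self k volume z]

lemma BoundedDensity.integrable_mul_inv {ψ : ℂ → ℂ} (hψ : BoundedDensity ψ) (z : ℂ) :
    Integrable (fun w => ψ w * (z - w)⁻¹) := by
  obtain ⟨C, h⟩ := hψ.exists_majorant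
  obtain ⟨g, hg, hle, -⟩ := h z
  refine hg.mono' (hψ.aestronglyMeasurable.mul ?_) (Eventually.of_forall hle)
  exact (measurable_const.sub measurable_id).inv.aestronglyMeasurable

lemma cauchyTransform_add {ψ₁ ψ₂ : ℂ → ℂ} (h₁ : BoundedDensity ψ₁) (h₂ : BoundedDensity ψ₂)
    (z : ℂ) : cauchyTransform (fun w => ψ₁ w + ψ₂ w) z =
      cauchyTransform ψ₁ z + cauchyTransform ψ₂ z := by
  simp only [cauchyTransform, add_mul]
  rw [integral_add (h₁.integrable_mul_inv z) (h₂.integrable_mul_inv z), mul_add]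

lemma BoundedDensity.exists_norm_cauchyTransform_le {ψ : ℂ → ℂ} (hψ : BoundedDensity ψ) :
    ∃ C, ∀ z, ‖cauchyTransform ψ z‖ ≤ C := by
  obtain ⟨C, h⟩ := hψ.exists_majorant
  refine ⟨‖(Real.pi : ℂ)⁻¹‖ * C, fun z => ?_⟩
  obtain ⟨g, hg, hle, rfl⟩ := h z
  rw [cauchyTransform, norm_mul]
  gcongr
  exact norm_integral_le_of_norm_le hg (Eventually.of_forall hle)

lemma BoundedDensity.tendsto_cauchyTransform {ψ : ℂ → ℂ} (hψ : BoundedDensity ψ) :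
    Tendsto (cauchyTransform ψ) (cocompact ℂ) (𝓝 0) := by
  obtain ⟨M, hM⟩ := hψ.exists_bound
  obtain ⟨R, hR⟩ := hψ.exists_radius
  set b : ℂ → ℝ := (closedBall (0 : ℂ) R).indicator fun _ => 1 with hb
  have hbi : Integrable b := by
    rw [hb, integrable_indicator_iff isClosed_closedBall.measurableSet]
    exact continuousOn_const.integrableOn_compact (isCompact_closedBall _ _)
  have hM0 : 0 ≤ M := (norm_nonneg _).trans (hM 0)
  have hlim : Tendsto (fun z : ℂ => ‖(Real.pi : ℂ)⁻¹‖ * (M * (‖z‖ - R)⁻¹ * ∫ w, b w))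
      (cocompact ℂ) (𝓝 0) := by
    have h1 : Tendsto (fun z : ℂ => (‖z‖ - R)⁻¹) (cocompact ℂ) (𝓝 0) :=
      tendsto_inv_atTop_zero.comp
        (tendsto_atTop_add_const_right _ (-R) (tendsto_norm_cocompact_atTop (E := ℂ)))
    simpa using ((h1.const_mul M).mul_const (∫ w, b w)).const_mul ‖(Real.pi : ℂ)⁻¹‖
  refine squeeze_zero_norm' ?_ hlim
  filter_upwards [(tendsto_norm_cocompact_atTop (E := ℂ)).eventually_gt_atTop R] with z hz
  rw [cauchyTransform, norm_mul]
  gcongr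
  rw [← integral_const_mul]
  refine norm_integral_le_of_norm_le (hbi.const_mul _) (Eventually.of_forall fun w => ?_)
  by_cases hw : R < ‖w‖
  · have : 0 ≤ b w := indicator_nonneg (by simp) _
    have h3 : 0 ≤ (‖z‖ - R)⁻¹ := inv_nonneg.2 (by linarith)
    simp only [hR w hw, zero_mul, norm_zero]
    positivity
  · have hbw : b w = 1 := by
      rw [hb, indicator_of_mem (by simpa using hw)]
    rw [hbw, mul_one, norm_mul, norm_inv]
    have h4 : ‖z‖ - R ≤ ‖z - w‖ := by
      have := norm_sub_norm_le z w
      linarith [not_lt.1 hw]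
    exact mul_le_mul (hM w) (inv_anti₀ (by linarith) h4) (by positivity) hM0

/-- The Cauchy transform is holomorphic where its density vanishes. -/
lemma BoundedDensity.differentiableAt_cauchyTransform {ψ : ℂ → ℂ} (hψ : BoundedDensity ψ) {z : ℂ}
    (hz : ∀ᶠ w in 𝓝 z, ψ w = 0) : DifferentiableAt ℂ (cauchyTransform ψ) z := by
  obtain ⟨M, hM⟩ := hψ.exists_bound
  obtain ⟨R, hR⟩ := hψ.exists_radius
  obtain ⟨ε, hε, hball⟩ := Metric.eventually_nhds_iff_ball.1 hz
  have hM0 : 0 ≤ M := (norm_nonneg _).trans (hM 0)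
  set b : ℂ → ℝ := (closedBall (0 : ℂ) R).indicator fun _ => M * ((ε / 2)⁻¹) ^ 2 with hb
  have hbi : Integrable b := by
    rw [hb, integrable_indicator_iff isClosed_closedBall.measurableSet]
    exact continuousOn_const.integrableOn_compact (isCompact_closedBall _ _)
  have hb0 : ∀ w, 0 ≤ b w := fun w => indicator_nonneg (fun _ _ => by positivity) _
  have hfar : ∀ w, ψ w ≠ 0 → ∀ x ∈ ball z (ε / 2), ε / 2 ≤ ‖x - w‖ := by
    intro w hw x hx
    have h1 : ε ≤ dist w z := by
      by_contra h
      exact hw (hball w (not_le.1 h))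
    rw [mem_ball] at hx
    rw [← dist_eq_norm]
    linarith [dist_triangle w x z, dist_comm w x]
  have key := (hasDerivAt_integral_of_dominated_loc_of_deriv_le (μ := volume) (𝕜 := ℂ) (x₀ := z)
    (F := fun x w => ψ w * (x - w)⁻¹) (F' := fun x w => ψ w * (-((x - w)⁻¹) ^ 2)) (bound := b)
    (ball_mem_nhds z (half_pos hε))
    (Eventually.of_forall fun x => (hψ.integrable_mul_inv x).aestronglyMeasurable)
    (hψ.integrable_mul_inv z)
    (hψ.aestronglyMeasurable.mul
      ((measurable_const.sub measurable_id).inv.pow_const 2).neg.aestronglyMeasurable)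
    (Eventually.of_forall fun w x hx => ?_) hbi (Eventually.of_forall fun w x hx => ?_)).2
  · exact (key.differentiableAt.const_mul (Real.pi : ℂ)⁻¹)
  · by_cases hw : ψ w = 0
    · simpa [hw] using hb0 w
    · have hmem : w ∈ closedBall (0 : ℂ) R := by
        rw [mem_closedBall_zero_iff]
        by_contra h
        exact hw (hR w (not_le.1 h))
      rw [hb, indicator_of_mem hmem, norm_mul, norm_neg, norm_pow, norm_inv]
      have h5 := inv_anti₀ (half_pos hε) (hfar w hw x hx)
      exact mul_le_mul (hM w) (pow_le_pow_left₀ (by positivity) h5 2) (by positivity) hM0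
  · by_cases hw : ψ w = 0
    · simpa [hw] using hasDerivAt_const x (0 : ℂ)
    · have hne : x - w ≠ 0 := norm_pos_iff.1 ((half_pos hε).trans_le (hfar w hw x hx))
      have := ((hasDerivAt_id x).sub_const w).inv hne
      refine (this.const_mul (ψ w)).congr_deriv ?_
      simp only [id]
      field_simp

/-! ### Removable sets and functions on the sphere -/

lemma coe_mem_sphereCompl {E : Set ℂ} {z : ℂ} : (z : Sphere) ∈ sphereCompl E ↔ z ∉ E := by
  simp [sphereCompl]

lemma infty_mem_sphereCompl (E : Set ℂ) : (∞ : Sphere) ∈ sphereCompl E := by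
  simp [sphereCompl]

lemma atInfty_zero : atInfty 0 = ∞ := by simp [atInfty]

lemma atInfty_of_ne {w : ℂ} (hw : w ≠ 0) : atInfty w = ((w⁻¹ : ℂ) : Sphere) := by
  simp [atInfty, hw]

/-- Off a compact plane set, holomorphy on the sphere is holomorphy in the plane together with
holomorphy of `w ↦ F (1 / w)` at the single point `w = 0`. -/
lemma sphereHolomorphicOn_sphereCompl {E : Set ℂ} (hE : IsCompact E) {F : Sphere → ℂ}
    (h1 : DifferentiableOn ℂ (fun z : ℂ => F z) Eᶜ)
    (h2 : DifferentiableAt ℂ (fun w => F (atInfty w)) 0) :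
    SphereHolomorphicOn F (sphereCompl E) := by
  constructor
  · exact h1.mono fun z hz => coe_mem_sphereCompl.1 hz
  · intro w hw
    rcases eq_or_ne w 0 with rfl | h0
    · exact h2.differentiableWithinAt
    rw [mem_ofPred_eq, atInfty_of_ne h0, coe_mem_sphereCompl] at hw
    have h3 : DifferentiableAt ℂ (fun z : ℂ => F z) w⁻¹ :=
      (h1 _ hw).differentiableAt (hE.isClosed.isOpen_compl.mem_nhds hw)
    have h4 : DifferentiableAt ℂ (fun w : ℂ => F ((w⁻¹ : ℂ) : Sphere)) w :=
      h3.comp w (differentiableAt_inv h0)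
    refine (h4.congr_of_eventuallyEq ?_).differentiableWithinAt
    filter_upwards [isOpen_ne.mem_nhds h0] with x hx
    rw [atInfty_of_ne hx]

lemma eventually_inv_notMem {E : Set ℂ} (hE : IsCompact E) :
    ∀ᶠ w in 𝓝[≠] (0 : ℂ), w⁻¹ ∉ E :=
  (tendsto_inv₀_nhdsNE_zero.mono_right Metric.cobounded_eq_cocompact.le).eventually
    hE.compl_mem_cocompact

/-- For bounded holomorphic functions vanishing at `∞`, removability of `E` means that they
vanish off `E`. -/
lemma Removable.eq_zero {E : Set ℂ} (hr : Removable E) (hE : IsCompact E) {g : ℂ → ℂ}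
    (hd : DifferentiableOn ℂ g Eᶜ) (hb : ∃ C : ℝ, ∀ z ∉ E, ‖g z‖ ≤ C)
    (h0 : Tendsto g (cocompact ℂ) (𝓝 0)) : ∀ z ∉ E, g z = 0 := by
  set F : Sphere → ℂ := fun x => x.elim 0 g with hF
  have hopen := hE.isClosed.isOpen_compl
  have hF0 : F (atInfty 0) = 0 := by rw [atInfty_zero]; rfl
  have hFne : ∀ w : ℂ, w ≠ 0 → F (atInfty w) = g w⁻¹ := fun w hw => by
    rw [atInfty_of_ne hw]; rfl
  have hcont : ContinuousAt (fun w => F (atInfty w)) 0 := by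
    rw [continuousAt_iff_punctured_nhds, hF0]
    refine (h0.comp (tendsto_inv₀_nhdsNE_zero.mono_right
      Metric.cobounded_eq_cocompact.le)).congr' ?_
    filter_upwards [self_mem_nhdsWithin] with w hw
    exact (hFne w hw).symm
  have hinf : DifferentiableAt ℂ (fun w => F (atInfty w)) 0 := by
    refine (Complex.analyticAt_of_differentiable_on_punctured_nhds_of_continuousAt ?_
      hcont).differentiableAt
    filter_upwards [self_mem_nhdsWithin, eventually_inv_notMem hE] with w hw hwE
    have h3 : DifferentiableAt ℂ (fun w : ℂ => g w⁻¹) w :=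
      ((hd _ hwE).differentiableAt (hopen.mem_nhds hwE)).comp w (differentiableAt_inv hw)
    refine h3.congr_of_eventuallyEq ?_
    filter_upwards [isOpen_ne.mem_nhds hw] with x hx
    exact hFne x hx
  obtain ⟨c, hc⟩ := hr F ⟨sphereHolomorphicOn_sphereCompl hE hd hinf, by
    obtain ⟨C, hC⟩ := hb
    refine ⟨max C 0, fun x hx => ?_⟩
    induction x using OnePoint.rec with
    | infty => simp [hF]
    | coe z => exact (hC z (coe_mem_sphereCompl.1 hx)).trans (le_max_left _ _)⟩
  intro z hz
  have h1 : g z = c := hc z (coe_mem_sphereCompl.2 hz)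
  have h2 : (0 : ℂ) = c := hc ∞ (infty_mem_sphereCompl E)
  rw [h1, h2]

/-- A removable set has no interior point `a`, because of the function `1 / (z - a)`. -/
lemma Removable.dense_compl {E : Set ℂ} (hr : Removable E) (hE : IsCompact E) : Dense Eᶜ := by
  rw [← interior_eq_empty_iff_dense_compl, eq_empty_iff_forall_notMem]
  intro a ha
  obtain ⟨ε, hε, hball⟩ := Metric.mem_nhds_iff.1 (mem_interior_iff_mem_nhds.1 ha)
  have hne : ∀ z ∉ E, z - a ≠ 0 := fun z hz h =>
    hz (by rw [sub_eq_zero.1 h]; exact interior_subset ha)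
  have hlim : Tendsto (fun z : ℂ => (z - a)⁻¹) (cocompact ℂ) (𝓝 0) := by
    rw [← Metric.cobounded_eq_cocompact]
    exact tendsto_inv₀_cobounded.comp (tendsto_sub_const_cobounded a)
  have h := hr.eq_zero hE (g := fun z => (z - a)⁻¹) (fun z hz =>
    ((differentiableAt_id.sub_const a).inv (hne z hz)).differentiableWithinAt)
    ⟨ε⁻¹, fun z hz => by
      rw [norm_inv]
      refine inv_anti₀ hε ?_
      by_contra h'
      exact hz (hball (by rw [mem_ball, dist_eq_norm]; exact not_le.1 h'))⟩ hlim
  obtain ⟨z, hz⟩ := nonempty_compl.2 hE.ne_univ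
  exact inv_ne_zero (hne z hz) (h z hz)

/-! ### Localization -/

/-- A `C¹` cutoff function, complex valued so that it can be multiplied with holomorphic functions
and differentiated by `dbar`. -/
lemma exists_cutoff {V : Set ℂ} (hV : IsOpen V) {p : ℂ} (hp : p ∈ V) :
    ∃ φ : ℂ → ℂ, ContDiff ℝ 1 φ ∧ HasCompactSupport φ ∧ tsupport φ ⊆ V ∧
      (∀ᶠ z in 𝓝 p, φ z = 1) ∧ ∀ z, ‖φ z‖ ≤ 1 := by
  obtain ⟨ε, hε, hball⟩ := Metric.nhds_basis_closedBall.mem_iff.1 (hV.mem_nhds hp)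
  let b : ContDiffBump p := ⟨ε / 2, ε, half_pos hε, half_lt_self hε⟩
  have hsupp : Function.support (fun z => (b z : ℂ)) = Function.support b := by
    ext z
    simp
  have hts : tsupport (fun z => (b z : ℂ)) = closedBall p ε := by
    rw [tsupport, hsupp]
    exact b.tsupport_eq
  refine ⟨fun z => (b z : ℂ), Complex.ofRealCLM.contDiff.comp b.contDiff, ?_, ?_, ?_, ?_⟩
  · rw [HasCompactSupport, hts]
    exact isCompact_closedBall _ _
  · rwa [hts]
  · filter_upwards [b.eventuallyEq_one] with z hz
    simp [hz]
  · intro z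
    rw [Complex.norm_real, Real.norm_of_nonneg b.nonneg]
    exact b.le_one

/-- If `h` is holomorphic on the open set `W`, then `φ h` and the Cauchy transform of `h ∂φ/∂z̄`
differ by a holomorphic function on `W`, since both have the same `z̄`-derivative there. -/
lemma differentiableAt_mul_sub_cauchyTransform {W : Set ℂ} (hW : IsOpen W) {h φ : ℂ → ℂ}
    (hd : DifferentiableOn ℂ h W) (hm : AEStronglyMeasurable h) (hb : ∃ M, ∀ w, ‖h w‖ ≤ M)
    (hφ : ContDiff ℝ 1 φ) (hφc : HasCompactSupport φ) {z : ℂ} (hz : z ∈ W) :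
    DifferentiableAt ℂ (fun z => φ z * h z - cauchyTransform (fun w => h w * dbar φ w) z) z := by
  have hψ : BoundedDensity (fun w => h w * dbar φ w) :=
    (BoundedDensity.of_continuous (continuous_dbar hφ) (hasCompactSupport_dbar hφc)).mul hm hb
  obtain ⟨χ, hχ, hχc, hχW, hχ1, -⟩ := exists_cutoff hW hz
  have hhW : ∀ w ∈ W, ContDiffAt ℝ 1 h w := fun w hw =>
    ((hd.analyticAt (hW.mem_nhds hw)).contDiffAt (n := 1)).restrict_scalars ℝ
  set u : ℂ → ℂ := fun w => χ w * (φ w * h w) with hu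
  have huc : HasCompactSupport u := hχc.mul_right
  have hucd : ContDiff ℝ 1 u := by
    refine contDiff_iff_contDiffAt.2 fun w => ?_
    by_cases hw : w ∈ tsupport χ
    · exact hχ.contDiffAt.mul (hφ.contDiffAt.mul (hhW w (hχW hw)))
    · refine contDiffAt_const (c := (0 : ℂ)) |>.congr_of_eventuallyEq ?_
      filter_upwards [(isClosed_tsupport χ).isOpen_compl.mem_nhds hw] with x hx
      simp [hu, image_eq_zero_of_notMem_tsupport hx]
  have hdbar : ∀ w, dbar u w = χ w * (h w * dbar φ w) + h w * φ w * dbar χ w := by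
    intro w
    by_cases hw : w ∈ tsupport χ
    · have hhw := (hhW w (hχW hw)).differentiableAt one_ne_zero
      have hφw := hφ.differentiable one_ne_zero w
      rw [hu, dbar_mul (v := fun w => φ w * h w) (hχ.differentiable one_ne_zero w)
          (hφw.mul hhw), dbar_mul hφw hhw,
        dbar_eq_zero_of_differentiableAt (hd.differentiableAt (hW.mem_nhds (hχW hw)))]
      ring
    · have hw' : w ∉ tsupport u := fun h' => hw (tsupport_mul_subset_left h')
      rw [dbar_eq_zero_of_notMem_tsupport hw, dbar_eq_zero_of_notMem_tsupport hw',
        image_eq_zero_of_notMem_tsupport hw]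
      ring
  -- `h ∂φ/∂z̄` is `∂u/∂z̄` plus a density vanishing near `z`.
  set η : ℂ → ℂ := fun w => h w * ((1 - χ w) * dbar φ w - φ w * dbar χ w) with hη
  have hηb : BoundedDensity η := by
    refine (BoundedDensity.of_continuous ?_ ?_).mul hm hb
    · exact ((continuous_const.sub hχ.continuous).mul (continuous_dbar hφ)).sub
        (hφ.continuous.mul (continuous_dbar hχ))
    · exact (hasCompactSupport_dbar hφc).mul_left.sub hφc.mul_right
  have hη0 : ∀ᶠ w in 𝓝 z, η w = 0 := by
    filter_upwards [hχ1, eventually_eventually_nhds.2 hχ1] with w hw hw'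
    have : dbar χ w = 0 := by
      rw [dbar_congr (v := fun _ => 1) hw']
      exact dbar_eq_zero_of_differentiableAt (differentiableAt_const _)
    simp [hη, hw, this]
  have hsplit : (fun w => h w * dbar φ w) = fun w => dbar u w + η w := by
    ext w
    rw [hdbar, hη]
    ring
  have hC : ∀ x, cauchyTransform (fun w => h w * dbar φ w) x = u x + cauchyTransform η x := by
    intro x
    rw [hsplit, cauchyTransform_add (BoundedDensity.of_continuous (continuous_dbar hucd)
      (hasCompactSupport_dbar huc)) hηb, cauchyTransform_dbar hucd huc]
  refine (hηb.differentiableAt_cauchyTransform hη0).neg.congr_of_eventuallyEq ?_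
  filter_upwards [hχ1] with w hw
  simp [hC, hu, hw]

/-- Near each point of `U`, a bounded holomorphic function on `U \ E` is given off `E` by a
Cauchy transform holomorphic there. -/
lemma Removable.exists_local_extension {E : Set ℂ} (hr : Removable E) (hE : IsCompact E)
    {U : Set ℂ} (hU : IsOpen U) {f : ℂ → ℂ} (hf : MemPlane f (U \ E)) {p : ℂ} (hp : p ∈ U) :
    ∃ g : ℂ → ℂ, ∀ᶠ z in 𝓝 p, DifferentiableAt ℂ g z ∧ (z ∉ E → g z = f z) := by
  obtain ⟨hfd, C, hC⟩ := hf
  have hW : IsOpen (U \ E) := hU.sdiff hE.isClosed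
  obtain ⟨φ, hφ, hφc, hφU, hφ1, hφle⟩ := exists_cutoff hU hp
  set h : ℂ → ℂ := (U \ E).indicator f with hh
  have hhd : DifferentiableOn ℂ h (U \ E) :=
    hfd.congr fun z hz => indicator_of_mem hz f
  have hhm : AEStronglyMeasurable h :=
    (aestronglyMeasurable_indicator_iff hW.measurableSet).2
      (hfd.continuousOn.aestronglyMeasurable hW.measurableSet)
  have hhb : ∀ w, ‖h w‖ ≤ max C 0 := by
    intro w
    by_cases hw : w ∈ U \ E
    · rw [hh, indicator_of_mem hw]
      exact (hC w hw).trans (le_max_left _ _)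
    · rw [hh, indicator_of_notMem hw, norm_zero]
      exact le_max_right _ _
  have hψ : BoundedDensity (fun w => h w * dbar φ w) :=
    (BoundedDensity.of_continuous (continuous_dbar hφ) (hasCompactSupport_dbar hφc)).mul
      hhm ⟨_, hhb⟩
  -- `φ h - C (h ∂φ/∂z̄)` is bounded and holomorphic off `E` and vanishes at `∞`.
  have hzero := hr.eq_zero hE
    (g := fun z => φ z * h z - cauchyTransform (fun w => h w * dbar φ w) z) ?_ ?_ ?_
  · refine ⟨cauchyTransform (fun w => h w * dbar φ w), ?_⟩
    filter_upwards [hφ1, eventually_eventually_nhds.2 (eventually_eventually_nhds.2 hφ1),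
      hU.mem_nhds hp] with z hz hz' hzU
    refine ⟨hψ.differentiableAt_cauchyTransform ?_, fun hzE => ?_⟩
    · filter_upwards [hz'] with w hw
      rw [dbar_congr (v := fun _ => 1) hw,
        dbar_eq_zero_of_differentiableAt (differentiableAt_const _), mul_zero]
    · rw [← sub_eq_zero.1 (hzero z hzE), hz, one_mul]
      exact indicator_of_mem (show z ∈ U \ E from ⟨hzU, hzE⟩) f
  · intro z hz
    refine DifferentiableAt.differentiableWithinAt ?_
    by_cases hzφ : z ∈ tsupport φ
    · exact differentiableAt_mul_sub_cauchyTransform hW hhd hhm ⟨_, hhb⟩ hφ hφc ⟨hφU hzφ, hz⟩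
    · have hnhds := (isClosed_tsupport φ).isOpen_compl.mem_nhds hzφ
      refine (hψ.differentiableAt_cauchyTransform ?_).neg.congr_of_eventuallyEq ?_
      · filter_upwards [hnhds] with w hw
        rw [dbar_eq_zero_of_notMem_tsupport hw, mul_zero]
      · filter_upwards [hnhds] with w hw
        simp [image_eq_zero_of_notMem_tsupport hw]
  · obtain ⟨C', hC'⟩ := hψ.exists_norm_cauchyTransform_le
    refine ⟨1 * max C 0 + C', fun z _ => (norm_sub_le _ _).trans (add_le_add ?_ (hC' z))⟩
    rw [norm_mul]
    exact mul_le_mul (hφle z) (hhb z) (norm_nonneg _) zero_le_one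
  · have h1 : Tendsto (fun z => φ z * h z) (cocompact ℂ) (𝓝 0) := by
      refine tendsto_const_nhds.congr' ?_
      filter_upwards [hφc.compl_mem_cocompact] with z hz
      rw [image_eq_zero_of_notMem_tsupport hz, zero_mul]
    simpa using h1.sub hψ.tendsto_cauchyTransform

/-- Bounded holomorphic functions extend across a removable set. The local extensions fit
together because `U \ E` is dense in `U`. -/
lemma Removable.exists_extension {E : Set ℂ} (hr : Removable E) (hE : IsCompact E)
    {U : Set ℂ} (hU : IsOpen U) {f : ℂ → ℂ} (hf : MemPlane f (U \ E)) :
    ∃ g : ℂ → ℂ, MemPlane g U ∧ EqOn g f (U \ E) := by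
  have hcl : U ⊆ closure (U \ E) := by
    rw [sdiff_eq]
    exact (hr.dense_compl hE).open_subset_closure_inter hU
  have hlim : ∀ p ∈ U, ∀ g : ℂ → ℂ, DifferentiableAt ℂ g p →
      (∀ᶠ z in 𝓝 p, z ∉ E → g z = f z) → Tendsto f (𝓝[U \ E] p) (𝓝 (g p)) := by
    intro p _ g hg hgf
    refine (hg.continuousAt.tendsto.mono_left nhdsWithin_le_nhds).congr' ?_
    filter_upwards [self_mem_nhdsWithin, nhdsWithin_le_nhds hgf] with z hz hzf
    exact hzf hz.2
  refine ⟨extendFrom (U \ E) f, ⟨fun p hp => ?_, ?_⟩, extendFrom_extends hf.1.continuousOn⟩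
  · obtain ⟨g, hg⟩ := hr.exists_local_extension hE hU hf hp
    refine (hg.self_of_nhds.1.congr_of_eventuallyEq ?_).differentiableWithinAt
    filter_upwards [eventually_eventually_nhds.2 hg, hU.mem_nhds hp] with z hz hzU
    exact extendFrom_eq (hcl hzU)
      (hlim z hzU g hz.self_of_nhds.1 (hz.mono fun _ h => h.2))
  · obtain ⟨C, hC⟩ := hf.2
    refine ⟨C, fun p hp => ?_⟩
    obtain ⟨g, hg⟩ := hr.exists_local_extension hE hU hf hp
    have ht := hlim p hp g hg.self_of_nhds.1 (hg.mono fun _ h => h.2)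
    rw [extendFrom_eq (hcl hp) ht]
    have := mem_closure_iff_nhdsWithin_neBot.1 (hcl hp)
    exact le_of_tendsto ht.norm (eventually_nhdsWithin_of_forall hC)

/-- A bounded holomorphic function off `E ∪ F` extends across `E`, as a function on the plane
open set `Fᶜ`, and is then constant as `F` is removable. -/
lemma Removable.union {E F : Set ℂ} (hrE : Removable E) (hrF : Removable F) (hE : IsCompact E)
    (hF : IsCompact F) : Removable (E ∪ F) := by
  rintro f ⟨hf, C, hC⟩
  have hmem : ∀ z : ℂ, z ∈ Fᶜ \ E ↔ (z : Sphere) ∈ sphereCompl (E ∪ F) := fun z => by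
    rw [coe_mem_sphereCompl]
    simp only [Set.mem_sdiff, mem_compl_iff, mem_union]
    tauto
  obtain ⟨g, ⟨hgd, C', hC'⟩, hgf⟩ := hrE.exists_extension hE hF.isClosed.isOpen_compl
    (f := fun z => f z) ⟨hf.1.mono fun z hz => (hmem z).1 hz, C, fun z hz => hC _ ((hmem z).1 hz)⟩
  -- The neighbourhood of `∞` is unaffected: there `G` is `f`.
  set G : Sphere → ℂ := fun x => x.elim (f ∞) g with hG
  have hGf : ∀ x ∈ sphereCompl (E ∪ F), G x = f x := by
    intro x hx
    induction x using OnePoint.rec with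
    | infty => rfl
    | coe z => exact hgf ((hmem z).2 hx)
  have hnear : ∀ᶠ w in 𝓝 (0 : ℂ), atInfty w ∈ sphereCompl (E ∪ F) := by
    filter_upwards [eventually_nhdsWithin_iff.1 (eventually_inv_notMem (hE.union hF))] with w hw
    rcases eq_or_ne w 0 with rfl | h0
    · rw [atInfty_zero]
      exact infty_mem_sphereCompl _
    · rw [atInfty_of_ne h0, coe_mem_sphereCompl]
      exact hw h0
  have hinf : DifferentiableAt ℂ (fun w => G (atInfty w)) 0 := by
    refine (hf.2.differentiableAt hnear).congr_of_eventuallyEq ?_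
    filter_upwards [hnear] with w hw
    exact hGf _ hw
  obtain ⟨c, hc⟩ := hrF G ⟨sphereHolomorphicOn_sphereCompl hF hgd hinf, max C' C, fun x hx => by
    induction x using OnePoint.rec with
    | infty => exact (hC ∞ (infty_mem_sphereCompl _)).trans (le_max_right _ _)
    | coe z => exact (hC' z (coe_mem_sphereCompl.1 hx)).trans (le_max_left _ _)⟩
  refine ⟨c, fun x hx => ?_⟩
  rw [← hGf x hx]
  refine hc x fun hx' => hx ?_
  exact image_mono subset_union_right hx'

end HInfty

theorem mainTheorem6 :
    (∀ E F : Set ℂ, IsCompact E → IsCompact F → HInfty.Removable E → HInfty.Removable F →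
      HInfty.Removable (E ∪ F)) ∧
    (∀ (U E : Set ℂ), IsOpen U → IsCompact E → HInfty.Removable E →
      ∀ f : ℂ → ℂ, HInfty.MemPlane f (U \ E) →
        ∃ g : ℂ → ℂ, HInfty.MemPlane g U ∧ Set.EqOn g f (U \ E)) :=
  ⟨fun _ _ hE hF hrE hrF => hrE.union hrF hE hF,
    fun _ _ hU hE hr _ hf => hr.exists_extension hE hU hf⟩
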